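/- Let $\varphi=\frac{1+\sqrt5}{2}$ be the golden ratio and $\mathbb{N}=\{0,1,2,\dots\}$. A polynomial $P$ is called integer-valued if $P(n)\in\mathbb{Z}$ for all $n\in\mathbb{N}$. For every $\varepsilon>0$ there are infinitely many integer-valued polynomials $P$ that satisfy $$|P(n)|\le\left(\sqrt{2\varphi}+\varepsilon\right)\varphi^n\quad\text{for all } n\in\mathbb{N}.$$ -/

import Mathlib

/-- A polynomial is integer-valued if it takes integer values at all natural numbers
`0, 1, 2, …`. -/
def IsIntegerValued (P : Polynomial ℝ) : Prop :=
  ∀ n : ℕ, ∃ m : ℤ, P.eval (n : ℝ) = (m : ℝ)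

/-! Integer combinations $P=\sum_{k<m}a_k\binom Xk$ turn the bounds on $P(n)$, $n<N$, into $N$
linear inequalities on $a\in\mathbb Z^m$, with $N$ possibly far larger than $m$. Put
$\alpha=1/\varphi$. Sending $X^k$ to $\binom nk$ and re-expanding in powers of $X-\alpha$ is a
unimodular change of coordinates. Because $\alpha(1+\alpha)=1$, the new matrix of $\alpha^nP(n)$
obeys an all-pass recurrence along both rows and columns, so all their squared norms are at most
$(1-\alpha^2)^{-1}=\varphi$ (`sum_shiftedEval_sq_row`, `sum_shiftedEval_sq_col`). After division by
$\sqrt\varphi$ every form has norm at most 1, and the squared norms sum to at most $m$.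

`exp_le_ncard_of_forms` then finds many lattice points at which all forms are at most $\sqrt2$.
Divide the forms by $\sqrt2$, round their values and give each tuple of roundings a product of
probability weights. The integral of this weight over $\mathbb R^m$ is at most the number of such
points, by averaging over translates of a lattice of covolume 1 and a weighted pigeonhole. Gibbs'
inequality against the density $e^{-\pi|x|^2}$ bounds it below by $e^{m/2-0.44m}$, since a form of
squared norm $Q$ costs at most $0.44Q$.

The count is unbounded in $m$. Only finitely many $a$ meet the bounds for $n<m$, so one $N$ can be
chosen beyond which all their polynomials stay below $\varphi^n$. -/

open MeasureTheory ProbabilityTheory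

/-! ### Binomial functional and all-pass recurrences -/

/-- The linear functional on real polynomials sending `X ^ k` to `n.choose k`. -/
noncomputable def binomEval (n : ℕ) : Polynomial ℝ →ₗ[ℝ] ℝ :=
  ∑ i ∈ Finset.range (n + 1), (n.choose i : ℝ) • Polynomial.lcoeff ℝ i

theorem binomEval_apply (n : ℕ) (A : Polynomial ℝ) :
    binomEval n A = ∑ i ∈ Finset.range (n + 1), (n.choose i : ℝ) * A.coeff i := by
  simp [binomEval]

theorem binomEval_X_mul_succ (n : ℕ) (A : Polynomial ℝ) :
    binomEval (n + 1) (Polynomial.X * A) = binomEval n (Polynomial.X * A) + binomEval n A := by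
  simp only [binomEval_apply]
  have e : ∑ i ∈ Finset.range (n + 1), (n.choose (i + 1) : ℝ) * A.coeff i
      = ∑ i ∈ Finset.range n, (n.choose (i + 1) : ℝ) * A.coeff i := by
    rw [Finset.sum_range_succ]; simp
  have e' : ∑ i ∈ Finset.range (n + 1), (n.choose i : ℝ) * (Polynomial.X * A).coeff i
      = ∑ i ∈ Finset.range n, (n.choose (i + 1) : ℝ) * A.coeff i := by
    rw [Finset.sum_range_succ']; simp [Polynomial.coeff_X_mul]
  rw [Finset.sum_range_succ' _ (n + 1), e', ← e]
  simp only [Polynomial.coeff_X_mul, Polynomial.mul_coeff_zero, Polynomial.coeff_X_zero, zero_mul,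
    mul_zero, add_zero, Nat.choose_succ_succ', Nat.cast_add, add_mul, Finset.sum_add_distrib]
  rw [add_comm]

theorem binomEval_X_pow (n k : ℕ) : binomEval n (Polynomial.X ^ k) = n.choose k := by
  rw [binomEval_apply]
  simp only [Polynomial.coeff_X_pow, mul_ite, mul_one, mul_zero]
  rw [Finset.sum_ite_eq']
  split_ifs with h
  · rfl
  · rw [Nat.choose_eq_zero_of_lt (by simpa using h)]; simp

/-- The energy of the output of a first order all-pass filter is at most that of its input. -/
theorem sum_sq_le_of_allPass {a : ℝ} (ha0 : 0 ≤ a) (ha1 : a < 1) {x y : ℕ → ℝ}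
    (h0 : y 0 = -a * x 0) (h : ∀ n, y (n + 1) = a * y n + x n - a * x (n + 1)) (N : ℕ) :
    ∑ i ∈ Finset.range N, y i ^ 2 ≤ ∑ i ∈ Finset.range N, x i ^ 2 := by
  -- The square `(a * y n + x n) ^ 2` is the energy stored in the filter, which makes the balance
  -- exact at every time.
  have key : ∀ n, (1 - a ^ 2) * ∑ i ∈ Finset.range (n + 1), y i ^ 2 + (a * y n + x n) ^ 2
      = (1 - a ^ 2) * ∑ i ∈ Finset.range (n + 1), x i ^ 2 := by
    intro n
    induction n with
    | zero => simp only [zero_add, Finset.range_one, Finset.sum_singleton, h0]; ring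
    | succ n ih =>
      rw [Finset.sum_range_succ, Finset.sum_range_succ (fun i ↦ x i ^ 2), mul_add, mul_add, ← ih, h]
      ring
  rcases N with _ | n
  · simp
  · have ha : 0 < 1 - a ^ 2 := by nlinarith
    have := key n
    refine le_of_mul_le_mul_left ?_ ha
    nlinarith [sq_nonneg (a * y n + x n)]

/-- `a ^ n` times the value at `n` of the integer-valued polynomial attached to `(X - a) ^ j`. -/
noncomputable def shiftedEval (a : ℝ) (n j : ℕ) : ℝ :=
  a ^ n * binomEval n ((Polynomial.X - Polynomial.C a) ^ j)

theorem shiftedEval_zero_right (a : ℝ) (n : ℕ) : shiftedEval a n 0 = a ^ n := by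
  have := binomEval_X_pow n 0
  simp only [pow_zero, Nat.choose_zero_right, Nat.cast_one] at this
  simp [shiftedEval, this]

theorem shiftedEval_zero_left (a : ℝ) (j : ℕ) : shiftedEval a 0 j = (-a) ^ j := by
  simp [shiftedEval, binomEval_apply, Polynomial.coeff_zero_eq_eval_zero]

/-- Pascal's rule produces `shiftedEval a n j` with coefficient `a * (1 + a)`; the value 1 is what
makes the recurrence all-pass. -/
theorem shiftedEval_succ_succ {a : ℝ} (ha : a * (1 + a) = 1) (n j : ℕ) :
    shiftedEval a (n + 1) (j + 1) =
      a * shiftedEval a n (j + 1) + shiftedEval a n j - a * shiftedEval a (n + 1) j := by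
  simp only [shiftedEval]
  set A := (Polynomial.X - Polynomial.C a) ^ j with hA
  have e : (Polynomial.X - Polynomial.C a) ^ (j + 1) = Polynomial.X * A - a • A := by
    rw [pow_succ', sub_mul, Polynomial.smul_eq_C_mul]
  rw [e, map_sub, map_sub, binomEval_X_mul_succ, map_smul, map_smul, smul_eq_mul, smul_eq_mul]
  linear_combination (a ^ n * binomEval n A) * ha

theorem sum_geom_sq_le {a : ℝ} (ha0 : 0 ≤ a) (ha1 : a < 1) (N : ℕ) :
    ∑ i ∈ Finset.range N, (a ^ i) ^ 2 ≤ (1 - a ^ 2)⁻¹ := by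
  have h : a ^ 2 < 1 := by nlinarith
  simp_rw [← pow_mul, mul_comm _ 2, pow_mul]
  rw [← tsum_geometric_of_lt_one (sq_nonneg a) h]
  exact (summable_geometric_of_lt_one (sq_nonneg a) h).sum_le_tsum _ (fun _ _ ↦ by positivity)

theorem sum_shiftedEval_sq_col {a : ℝ} (ha0 : 0 ≤ a) (ha1 : a < 1) (ha : a * (1 + a) = 1)
    (N j : ℕ) : ∑ n ∈ Finset.range N, shiftedEval a n j ^ 2 ≤ (1 - a ^ 2)⁻¹ := by
  induction j with
  | zero => simpa only [shiftedEval_zero_right] using sum_geom_sq_le ha0 ha1 N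
  | succ j ih =>
    refine (sum_sq_le_of_allPass ha0 ha1 ?_ (fun n ↦ shiftedEval_succ_succ ha n j) N).trans ih
    rw [shiftedEval_zero_left, shiftedEval_zero_left, pow_succ']

theorem sum_shiftedEval_sq_row {a : ℝ} (ha0 : 0 ≤ a) (ha1 : a < 1) (ha : a * (1 + a) = 1)
    (m n : ℕ) : ∑ j ∈ Finset.range m, shiftedEval a n j ^ 2 ≤ (1 - a ^ 2)⁻¹ := by
  induction n with
  | zero =>
    refine le_trans (le_of_eq ?_) (sum_geom_sq_le ha0 ha1 m)
    refine Finset.sum_congr rfl fun j _ ↦ ?_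
    rw [shiftedEval_zero_left, ← pow_mul, ← pow_mul, mul_comm, pow_mul, pow_mul, neg_sq]
  | succ n ih =>
    -- Alternating signs turn the same recurrence, read along `j`, into the all-pass form.
    have := sum_sq_le_of_allPass ha0 ha1 (x := fun j ↦ (-1) ^ j * shiftedEval a n j)
      (y := fun j ↦ -((-1) ^ j * shiftedEval a (n + 1) j)) ?_ ?_ m
    · simp only [neg_sq, mul_pow, ← pow_mul, mul_comm _ 2] at this
      simp only [pow_mul, neg_sq, one_pow, one_mul] at this
      exact this.trans ih
    · simp only [shiftedEval_zero_right]; ring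
    · intro j
      rw [shiftedEval_succ_succ ha]
      ring

/-- Binomial expansion of $X^k=((X-a)+a)^k$ under the functional. -/
theorem sum_choose_mul_shiftedEval (a : ℝ) {m k : ℕ} (hk : k < m) (n : ℕ) :
    ∑ j ∈ Finset.range m, (k.choose j : ℝ) * a ^ (k - j) * shiftedEval a n j
      = a ^ n * n.choose k := by
  have hsub : Finset.range (k + 1) ⊆ Finset.range m := by
    intro i; simp only [Finset.mem_range]; omega
  rw [← Finset.sum_subset hsub]
  · have e : (Polynomial.X : Polynomial ℝ) ^ k = ∑ j ∈ Finset.range (k + 1),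
        ((k.choose j : ℝ) * a ^ (k - j)) • (Polynomial.X - Polynomial.C a) ^ j := by
      conv_lhs => rw [← sub_add_cancel (Polynomial.X : Polynomial ℝ) (Polynomial.C a), add_pow]
      refine Finset.sum_congr rfl fun j _ ↦ ?_
      rw [Polynomial.smul_eq_C_mul]
      simp only [map_mul, map_pow, map_natCast]
      ring
    rw [← binomEval_X_pow, e, map_sum, Finset.mul_sum]
    refine Finset.sum_congr rfl fun j _ ↦ ?_
    rw [map_smul, shiftedEval, smul_eq_mul]
    ring
  · intro j _ hj
    rw [Nat.choose_eq_zero_of_lt (by simpa using hj)]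
    simp

/-! ### Pigeonhole in rounding cells and lattice averaging -/

theorem abs_sub_le_one_of_round_eq {x y : ℝ} (h : round x = round y) : |x - y| ≤ 1 := by
  have hx := abs_sub_round x
  have hy := abs_sub_round y
  rw [h] at hx
  rw [abs_le] at *
  constructor <;> linarith [hx.1, hx.2, hy.1, hy.2]

/-- Weighted pigeonhole: lattice points of a translate, weighted by the cell they lie in, have
total weight at most the number of lattice points that are differences within one cell. -/
theorem tsum_prod_round_le {m N : ℕ} {E : Type*} [AddCommGroup E] [Module ℝ E]
    (y : Fin N → E →ₗ[ℝ] ℝ) (ℓ : (Fin m → ℤ) →+ E) (q : Fin N → ℤ → ENNReal)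
    (hq : ∀ n, ∑' k, q n k ≤ 1) {S : Set (Fin m → ℤ)} (hfin : S.Finite)
    (hS : ∀ a, (∀ n, |y n (ℓ a)| ≤ 1) → a ∈ S) (s : E) :
    ∑' a, ∏ n, q n (round (y n (s + ℓ a))) ≤ (S.ncard : ENNReal) := by
  classical
  rw [ENNReal.tsum_eq_iSup_sum]
  refine iSup_le fun F ↦ ?_
  set κ : (Fin m → ℤ) → (Fin N → ℤ) := fun a n ↦ round (y n (s + ℓ a)) with hκ
  have hcard : ∀ k, ((F.filter (fun a ↦ κ a = k)).card : ENNReal) ≤ S.ncard := by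
    intro k
    rcases (F.filter (fun a ↦ κ a = k)).eq_empty_or_nonempty with h | ⟨a₀, h₀⟩
    · simp [h]
    · rw [Nat.cast_le, Set.ncard_eq_toFinset_card _ hfin]
      -- Subtracting one point of the cell injects the cell into `S`.
      refine Finset.card_le_card_of_injOn (fun a ↦ a - a₀) ?_ (fun _ _ _ _ h ↦ sub_left_injective h)
      intro a ha
      simp only [Finset.coe_filter, Set.mem_ofPred_eq, Finset.mem_filter] at ha h₀
      simp only [Set.Finite.coe_toFinset]
      refine hS _ fun n ↦ ?_
      have : round (y n (s + ℓ a)) = round (y n (s + ℓ a₀)) := congrFun (ha.2.trans h₀.2.symm) n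
      have := abs_sub_le_one_of_round_eq this
      rwa [← map_sub, add_sub_add_left_eq_sub, ← map_sub] at this
  calc ∑ a ∈ F, ∏ n, q n (κ a n)
      = ∑ k ∈ F.image κ, ∑ a ∈ F with κ a = k, ∏ n, q n (κ a n) :=
        (Finset.sum_fiberwise_of_maps_to (fun a ha ↦ Finset.mem_image_of_mem κ ha) _).symm
    _ = ∑ k ∈ F.image κ, ((F.filter (fun a ↦ κ a = k)).card : ENNReal) * ∏ n, q n (k n) := by
        refine Finset.sum_congr rfl fun k _ ↦ ?_
        rw [Finset.sum_congr rfl (g := fun _ ↦ ∏ n, q n (k n)), Finset.sum_const, nsmul_eq_mul]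
        intro a ha
        rw [(Finset.mem_filter.1 ha).2]
    _ ≤ ∑ k ∈ F.image κ, (S.ncard : ENNReal) * ∏ n, q n (k n) :=
        Finset.sum_le_sum fun k _ ↦ mul_le_mul_left (hcard k) _
    -- Enlarging the set of occupied cells to a box lets the sum factor.
    _ ≤ ∑ k ∈ Fintype.piFinset fun n ↦ F.image fun a ↦ κ a n,
          (S.ncard : ENNReal) * ∏ n, q n (k n) := by
        refine Finset.sum_le_sum_of_subset ?_
        intro k hk
        obtain ⟨a, ha, rfl⟩ := Finset.mem_image.1 hk
        exact Fintype.mem_piFinset.2 fun n ↦ Finset.mem_image.2 ⟨a, ha, rfl⟩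
    _ = (S.ncard : ENNReal) * ∏ n, ∑ k ∈ F.image fun a ↦ κ a n, q n k := by
        rw [← Finset.mul_sum, Finset.prod_univ_sum]
    _ ≤ (S.ncard : ENNReal) * 1 := by
        refine mul_le_mul_right (Finset.prod_le_one' fun n _ ↦ ?_) _
        exact (ENNReal.sum_le_tsum _).trans (hq n)
    _ = S.ncard := mul_one _

/-- The integral unfolds to that of the periodization over a fundamental domain, whose volume is 1.
-/
theorem lintegral_le_of_tsum_le {m : ℕ} (b : Module.Basis (Fin m) ℝ (Fin m → ℝ))
    (hb : |(Matrix.of b).det| = 1) {f : (Fin m → ℝ) → ENNReal} (hf : Measurable f) {M : ENNReal}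
    (h : ∀ s, ∑' a : Fin m → ℤ, f (s + ∑ k, a k • b k) ≤ M) : ∫⁻ x, f x ≤ M := by
  have hF := ZSpan.isAddFundamentalDomain b (volume : Measure (Fin m → ℝ))
  have : VAddInvariantMeasure (Submodule.span ℤ (Set.range b)) (Fin m → ℝ) volume :=
    inferInstanceAs <| VAddInvariantMeasure (Submodule.span ℤ (Set.range b)).toAddSubgroup _ _
  have : Countable (Submodule.span ℤ (Set.range b)) :=
    (b.restrictScalars ℤ).equivFun.toEquiv.injective.countable
  rw [hF.lintegral_eq_tsum'', ← lintegral_tsum]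
  · calc ∫⁻ x in ZSpan.fundamentalDomain b, ∑' g : Submodule.span ℤ (Set.range b), f (g +ᵥ x)
        ≤ ∫⁻ x in ZSpan.fundamentalDomain b, M := by
          refine lintegral_mono fun x ↦ le_trans (le_of_eq ?_) (h x)
          rw [← (b.restrictScalars ℤ).equivFun.symm.toEquiv.tsum_eq]
          refine tsum_congr fun a ↦ congrArg f ?_
          simp only [LinearEquiv.coe_toEquiv, Module.Basis.equivFun_symm_apply,
            Submodule.vadd_def, vadd_eq_add, Submodule.coe_sum, Submodule.coe_smul,
            Module.Basis.restrictScalars_apply]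
          exact add_comm _ _
      _ = M := by
          rw [setLIntegral_const, ZSpan.volume_fundamentalDomain, hb]; simp
  · exact fun g ↦ (hf.comp (measurable_const_vadd _)).aemeasurable

/-! ### Gaussian product measures -/

theorem integral_pi_gaussianReal_sq {m : ℕ} (v : NNReal) (j : Fin m) :
    Integrable (fun x : Fin m → ℝ ↦ x j ^ 2) (Measure.pi fun _ ↦ gaussianReal 0 v) ∧
    ∫ x : Fin m → ℝ, x j ^ 2 ∂(Measure.pi fun _ ↦ gaussianReal 0 v) = v := by
  have hmp := measurePreserving_eval (fun _ : Fin m ↦ gaussianReal 0 v) j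
  have hi : Integrable (fun x : ℝ ↦ x ^ 2) (gaussianReal 0 v) :=
    (memLp_id_gaussianReal' 2 (by simp)).integrable_sq
  refine ⟨hmp.integrable_comp_of_integrable hi, ?_⟩
  have h1 : ∫ x : Fin m → ℝ, x j ^ 2 ∂(Measure.pi fun _ ↦ gaussianReal 0 v)
      = ∫ x, x ^ 2 ∂(gaussianReal 0 v) := by
    have := integral_map (μ := Measure.pi fun _ : Fin m ↦ gaussianReal 0 v)
      (f := fun x : ℝ ↦ x ^ 2) hmp.measurable.aemeasurable (by fun_prop)
    rw [hmp.map_eq] at this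
    exact this.symm
  rw [h1, ← variance_fun_id_gaussianReal (μ := 0) (v := v), variance_of_integral_eq_zero
    (by fun_prop) integral_id_gaussianReal]

theorem pi_gaussianReal_eq_withDensity {m : ℕ} {v : NNReal} (hv : v ≠ 0) :
    Measure.pi (fun _ : Fin m ↦ gaussianReal 0 v) =
      volume.withDensity fun x ↦ ENNReal.ofReal (∏ j, gaussianPDFReal 0 v (x j)) := by
  refine Measure.pi_eq fun s hs ↦ ?_
  have hint : ∀ j, Integrable ((s j).indicator (gaussianPDFReal 0 v)) :=
    fun j ↦ (integrable_gaussianPDFReal 0 v).indicator (hs j)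
  have hnn : ∀ j x, 0 ≤ (s j).indicator (gaussianPDFReal 0 v) x :=
    fun j x ↦ Set.indicator_nonneg (fun _ _ ↦ gaussianPDFReal_nonneg _ _ _) _
  have e : (Set.univ.pi s).indicator
      (fun x : Fin m → ℝ ↦ ENNReal.ofReal (∏ j, gaussianPDFReal 0 v (x j)))
      = fun x ↦ ENNReal.ofReal (∏ j, (s j).indicator (gaussianPDFReal 0 v) (x j)) := by
    ext x
    by_cases hx : x ∈ Set.univ.pi s
    · rw [Set.indicator_of_mem hx]
      congr 1
      refine Finset.prod_congr rfl fun j _ ↦ ?_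
      rw [Set.indicator_of_mem (hx j trivial)]
    · rw [Set.indicator_of_notMem hx]
      simp only [Set.mem_pi, Set.mem_univ, true_implies, not_forall] at hx
      obtain ⟨j, hj⟩ := hx
      rw [Finset.prod_eq_zero (Finset.mem_univ j) (Set.indicator_of_notMem hj _),
        ENNReal.ofReal_zero]
  rw [withDensity_apply _ (MeasurableSet.univ_pi hs), ← lintegral_indicator (MeasurableSet.univ_pi hs),
    e, ← ofReal_integral_eq_lintegral_ofReal, integral_fintype_prod_volume_eq_prod,
    ENNReal.ofReal_prod_of_nonneg fun j _ ↦ integral_nonneg (hnn j)]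
  · refine Finset.prod_congr rfl fun j _ ↦ ?_
    rw [gaussianReal_apply_eq_integral _ hv, integral_indicator (hs j)]
  · exact Integrable.fintype_prod hint
  · exact Filter.Eventually.of_forall fun x ↦ Finset.prod_nonneg fun j _ ↦ hnn j _

theorem map_sum_mul_pi_gaussianReal {m : ℕ} (v w : NNReal) (c : Fin m → ℝ)
    (hw : (w : ℝ) = (∑ j, c j ^ 2) * v) :
    (Measure.pi fun _ : Fin m ↦ gaussianReal 0 v).map (fun x ↦ ∑ j, c j * x j)
      = gaussianReal 0 w := by
  have hm : Measurable fun x : Fin m → ℝ ↦ ∑ j, c j * x j := by fun_prop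
  have : IsProbabilityMeasure ((Measure.pi fun _ : Fin m ↦ gaussianReal 0 v).map
    (fun x ↦ ∑ j, c j * x j)) := Measure.isProbabilityMeasure_map hm.aemeasurable
  refine Measure.ext_of_charFun ?_
  ext t
  rw [charFun_gaussianReal, charFun_apply_real, integral_map hm.aemeasurable (by fun_prop)]
  have e : ∀ x : Fin m → ℝ, Complex.exp (t * ((∑ j, c j * x j : ℝ) : ℂ) * Complex.I)
      = ∏ j, Complex.exp (((t * c j : ℝ) : ℂ) * (x j : ℂ) * Complex.I) := by
    intro x
    rw [← Complex.exp_sum]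
    push_cast
    rw [Finset.mul_sum, Finset.sum_mul]
    congr 1
    exact Finset.sum_congr rfl fun j _ ↦ by ring
  simp_rw [e]
  rw [integral_fintype_prod_eq_prod
    (f := fun j (x : ℝ) ↦ Complex.exp (((t * c j : ℝ) : ℂ) * (x : ℂ) * Complex.I))]
  simp_rw [← charFun_apply_real, charFun_gaussianReal]
  rw [← Complex.exp_sum]
  have hw' : (w : ℂ) = (∑ j, (c j : ℂ) ^ 2) * v := by exact_mod_cast congrArg (fun r : ℝ ↦ (r : ℂ)) hw
  congr 1
  rw [hw', Finset.sum_mul, Finset.sum_mul, Finset.sum_div]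
  simp only [Complex.ofReal_zero, mul_zero, zero_mul, zero_sub, Finset.sum_neg_distrib]
  congr 1
  refine Finset.sum_congr rfl fun j _ ↦ ?_
  push_cast
  ring

/-! ### Cost of rounding a Gaussian variable -/

/-- An upper bound for `|round y|` that vanishes where `round y` does (up to ties). -/
noncomputable def roundBound (y : ℝ) : ℝ := if 1 / 2 ≤ |y| then 2 * |y| else 0

theorem abs_round_le_roundBound (y : ℝ) : |(round y : ℝ)| ≤ roundBound y := by
  have h := abs_sub_round y
  have h2 : |(round y : ℝ)| ≤ |y| + 1 / 2 := by
    calc |(round y : ℝ)| = |y - (y - round y)| := by ring_nf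
      _ ≤ |y| + |y - round y| := abs_sub _ _
      _ ≤ _ := by linarith
  unfold roundBound
  split_ifs with hy
  · linarith
  · have : |((round y : ℤ) : ℝ)| < 1 := by linarith
    have h3 : |round y| < 1 := by exact_mod_cast this
    rw [Int.abs_lt_one_iff.1 h3]; simp

theorem roundBound_nonneg (y : ℝ) : 0 ≤ roundBound y := by
  unfold roundBound; split_ifs <;> positivity

theorem roundBound_le (y : ℝ) : roundBound y ≤ 2 * |y| := by
  unfold roundBound; split_ifs
  · exact le_rfl
  · positivity

theorem measurable_roundBound : Measurable roundBound := by
  unfold roundBound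
  refine Measurable.ite ?_ (by fun_prop) measurable_const
  exact measurableSet_le measurable_const (by fun_prop)

theorem integrable_roundBound_gaussianReal (w : NNReal) :
    Integrable roundBound (gaussianReal 0 w) := by
  have h : Integrable (fun x : ℝ ↦ 2 * |x|) (gaussianReal 0 w) :=
    ((memLp_id_gaussianReal' 1 (by simp)).integrable le_rfl).abs.const_mul 2
  refine h.mono' measurable_roundBound.aestronglyMeasurable (Filter.Eventually.of_forall fun y ↦ ?_)
  rw [Real.norm_of_nonneg (roundBound_nonneg y)]
  exact roundBound_le y

/-- By symmetry this is a half-line integral of `2 * x` times twice the density, and `-(2 * w)`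
times the density is an antiderivative of `2 * x` times it. -/
theorem integral_roundBound_gaussianReal {w : NNReal} (hw : w ≠ 0) :
    ∫ y, roundBound y ∂(gaussianReal 0 w) = 4 * w * gaussianPDFReal 0 w (1 / 2) := by
  have hw0 : (0 : ℝ) < w := by positivity
  set F : ℝ → ℝ := (Set.Ici (1 / 2)).indicator fun x ↦ 2 * x * gaussianPDFReal 0 w x with hF
  have e : ∀ y, gaussianPDFReal 0 w y • roundBound y = F |y| := by
    intro y
    have : gaussianPDFReal 0 w |y| = gaussianPDFReal 0 w y := by simp [gaussianPDFReal]
    simp only [hF, Set.indicator_apply, Set.mem_Ici, this, roundBound, smul_eq_mul]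
    split_ifs <;> ring
  have hd : ∀ x ∈ Set.Ici (1 / 2 : ℝ), HasDerivAt (fun x ↦ -(2 * w) * gaussianPDFReal 0 w x)
      (2 * x * gaussianPDFReal 0 w x) x := by
    intro x _
    simp only [gaussianPDFReal_def, sub_zero]
    have h1 : HasDerivAt (fun x : ℝ ↦ -x ^ 2 / (2 * w)) (-(2 * x) / (2 * w)) x := by
      simpa using (((hasDerivAt_pow 2 x).neg).div_const (2 * (w : ℝ)))
    convert! ((h1.exp).const_mul ((√(2 * Real.pi * w))⁻¹)).const_mul (-(2 * (w : ℝ))) using 1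
    field_simp
  have hlim : Filter.Tendsto (fun x ↦ -(2 * w) * gaussianPDFReal 0 w x) Filter.atTop (nhds 0) := by
    have h2 : Filter.Tendsto (fun x : ℝ ↦ -x ^ 2 / (2 * w)) Filter.atTop Filter.atBot :=
      (Filter.tendsto_neg_atTop_atBot.comp (Filter.tendsto_pow_atTop two_ne_zero)).atBot_div_const
        (by positivity)
    have h3 := ((Real.tendsto_exp_atBot.comp h2).const_mul
      ((√(2 * Real.pi * w))⁻¹)).const_mul (-(2 * (w : ℝ)))
    simpa [gaussianPDFReal_def] using h3
  rw [integral_gaussianReal_eq_integral_smul hw]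
  simp_rw [e]
  rw [integral_comp_abs, hF, setIntegral_indicator measurableSet_Ici]
  have : Set.Ioi (0 : ℝ) ∩ Set.Ici (1 / 2) = Set.Ici (1 / 2) := by
    ext x; simp only [Set.mem_inter_iff, Set.mem_Ioi, Set.mem_Ici]
    exact ⟨fun h ↦ h.2, fun h ↦ ⟨by linarith, h⟩⟩
  rw [this, integral_Ici_eq_integral_Ioi, integral_Ioi_of_hasDerivAt_of_nonneg' hd ?_ hlim]
  · ring
  · intro x hx
    have : (1 / 2 : ℝ) < x := hx
    have := gaussianPDFReal_nonneg 0 w x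
    positivity

theorem log_one_add_div_one_sub_le {u : ℝ} (h0 : 0 < u) (h1 : u ≤ 1) :
    Real.log ((1 + u / 20) / (1 - u / 20)) ≤ 0.11 * u := by
  have hd : 0 < 1 - u / 20 := by linarith
  refine (Real.log_le_sub_one_of_pos (by positivity)).trans ?_
  rw [div_sub_one hd.ne', div_le_iff₀ hd]
  nlinarith

/-- The contribution of the tails of a Gaussian variable of variance `u / (4π)` to the bound on the
entropy of its rounding. -/
theorem neg_log_mul_integral_roundBound_le {u : ℝ} (h0 : 0 < u) (h1 : u ≤ 1) {w : NNReal}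
    (hw : (w : ℝ) = u / (4 * Real.pi)) :
    -Real.log (u / 20) * ∫ y, roundBound y ∂(gaussianReal 0 w) ≤ 0.33 * u := by
  have hpi := Real.pi_pos
  have hw0 : w ≠ 0 := by
    have : (0 : ℝ) < w := by rw [hw]; positivity
    exact_mod_cast this.ne'
  set v := u⁻¹ with hv
  have hv1 : 1 ≤ v := (one_le_inv₀ h0).2 h1
  have huv : u * v = 1 := mul_inv_cancel₀ h0.ne'
  have hval : ∫ y, roundBound y ∂(gaussianReal 0 w)
      = √2 / Real.pi * √u * Real.exp (-(Real.pi / 2 * v)) := by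
    rw [integral_roundBound_gaussianReal hw0, gaussianPDFReal_def, hw]
    have e1 : -(1 / 2 - 0) ^ 2 / (2 * (u / (4 * Real.pi))) = -(Real.pi / 2 * v) := by
      rw [hv]; field_simp; norm_num
    have e2 : 2 * Real.pi * (u / (4 * Real.pi)) = u / 2 := by field_simp; norm_num
    simp only [e1, e2]
    rw [Real.sqrt_div h0.le, inv_div]
    have : √u * √u = u := Real.mul_self_sqrt h0.le
    have hu : 0 < √u := Real.sqrt_pos.2 h0
    field_simp
    nlinarith
  rw [hval]
  have hlog20 : Real.log 20 ≤ 3 := by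
    rw [Real.log_le_iff_le_exp (by norm_num)]
    have := Real.exp_one_gt_d9
    have e : Real.exp 3 = Real.exp 1 ^ 3 := by rw [← Real.exp_nat_mul]; norm_num
    rw [e]
    calc (20 : ℝ) ≤ 2.7182 ^ 3 := by norm_num
      _ ≤ _ := by gcongr; linarith
  have hlog : -Real.log (u / 20) ≤ 2 + v := by
    rw [← Real.log_inv, inv_div, div_eq_mul_inv, ← hv, Real.log_mul (by norm_num) (by positivity)]
    have := Real.log_le_sub_one_of_pos (show 0 < v by positivity)
    linarith
  have hsq2 : √2 / Real.pi ≤ 0.4502 := by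
    rw [div_le_iff₀ hpi]
    have : √2 ≤ 1.41422 := by rw [Real.sqrt_le_left (by norm_num)]; norm_num
    have := Real.pi_gt_d4
    linarith
  have hsu : √u ≤ u * ((1 + v) / 2) := by
    have : √u ≤ (1 + u) / 2 := by nlinarith [sq_nonneg (1 - √u), Real.mul_self_sqrt h0.le]
    linarith
  -- What remains is a quadratic in `v = u⁻¹ ≥ 1`, beaten by $e^{\pi v/2}$ through
  -- $e^{3/2}\ge\sqrt{20}\ge4.4$ and a quadratic Taylor bound.
  have hexp : Real.exp (-(Real.pi / 2 * v)) * (0.4502 * ((2 + v) * ((1 + v) / 2))) ≤ 0.33 := by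
    rw [Real.exp_neg, inv_mul_le_iff₀ (Real.exp_pos _)]
    have ha : Real.exp (3 / 2) * Real.exp (3 / 2 * (v - 1)) ≤ Real.exp (Real.pi / 2 * v) := by
      rw [← Real.exp_add, Real.exp_le_exp]
      nlinarith [Real.pi_gt_three]
    have hb : 4.4 ≤ Real.exp (3 / 2) := by
      have h3 : Real.log 20 / 2 ≤ 3 / 2 := by linarith
      have h4 := Real.exp_le_exp.2 h3
      rw [Real.exp_half, Real.exp_log (by norm_num)] at h4
      refine le_trans ?_ h4
      exact Real.le_sqrt_of_sq_le (by norm_num)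
    have hc := Real.quadratic_le_exp_of_nonneg (show 0 ≤ 3 / 2 * (v - 1) by linarith)
    have hd : 4.4 * (1 + 3 / 2 * (v - 1) + (3 / 2 * (v - 1)) ^ 2 / 2) ≤
        Real.exp (Real.pi / 2 * v) :=
      (mul_le_mul hb hc (by nlinarith) (by positivity)).trans ha
    nlinarith [sq_nonneg (v - 1)]
  calc -Real.log (u / 20) * (√2 / Real.pi * √u * Real.exp (-(Real.pi / 2 * v)))
      ≤ (2 + v) * (0.4502 * (u * ((1 + v) / 2)) * Real.exp (-(Real.pi / 2 * v))) := by gcongr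
    _ = u * (Real.exp (-(Real.pi / 2 * v)) * (0.4502 * ((2 + v) * ((1 + v) / 2)))) := by ring
    _ ≤ u * 0.33 := by gcongr
    _ = _ := mul_comm _ _

/-! ### Geometric weights, Gibbs' inequality and the theorem on forms -/

/-- The weight of the integer `k` under the two-sided geometric distribution of ratio `r`. -/
noncomputable def geomWeight (r : ℝ) (k : ℤ) : ℝ :=
  Real.exp (-(Real.log ((1 + r) / (1 - r)) + -Real.log r * |(k : ℝ)|))

theorem geomWeight_eq {r : ℝ} (h0 : 0 < r) (h1 : r < 1) (k : ℤ) :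
    geomWeight r k = (1 - r) / (1 + r) * r ^ k.natAbs := by
  have hd : 0 < 1 - r := by linarith
  rw [geomWeight, neg_add, Real.exp_add, Real.exp_neg, Real.exp_log (by positivity), inv_div]
  congr 1
  rw [neg_mul, neg_neg, Real.exp_mul, Real.exp_log h0, ← Int.cast_abs, Int.abs_eq_natAbs]
  exact_mod_cast Real.rpow_natCast r _

theorem tsum_geomWeight_le {r : ℝ} (h0 : 0 < r) (h1 : r < 1) :
    ∑' k, ENNReal.ofReal (geomWeight r k) ≤ 1 := by
  have hd : 0 < 1 - r := by linarith
  have hg := hasSum_geometric_of_lt_one h0.le h1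
  have h : HasSum (fun k : ℤ ↦ r ^ k.natAbs) ((1 - r)⁻¹ + r * (1 - r)⁻¹) := by
    refine HasSum.of_nat_of_neg_add_one (by simpa using hg) ?_
    have := hg.mul_left r
    refine this.congr_fun ?_
    intro n
    have : (-((n : ℤ) + 1)).natAbs = n + 1 := by omega
    rw [this, pow_succ']
  have h2 : HasSum (geomWeight r) 1 := by
    have e : (1 - r) / (1 + r) * ((1 - r)⁻¹ + r * (1 - r)⁻¹) = 1 := by field_simp
    rw [funext (geomWeight_eq h0 h1)]
    have h3 := h.mul_left ((1 - r) / (1 + r))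
    rwa [e] at h3
  have hnn : ∀ k, 0 ≤ geomWeight r k := fun k ↦ (Real.exp_pos _).le
  rw [← ENNReal.ofReal_tsum_of_nonneg hnn h2.summable, h2.tsum_eq]
  simp

theorem ofReal_integral_le_lintegral_ofReal {α : Type*} [MeasurableSpace α] {μ : Measure α}
    {f : α → ℝ} (hf : Integrable f μ) :
    ENNReal.ofReal (∫ x, f x ∂μ) ≤ ∫⁻ x, ENNReal.ofReal (f x) ∂μ := by
  calc ENNReal.ofReal (∫ x, f x ∂μ) ≤ ENNReal.ofReal (∫ x, max (f x) 0 ∂μ) :=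
        ENNReal.ofReal_le_ofReal (integral_mono hf hf.pos_part fun x ↦ le_max_left _ _)
    _ = ∫⁻ x, ENNReal.ofReal (max (f x) 0) ∂μ :=
        ofReal_integral_eq_lintegral_ofReal hf.pos_part
          (Filter.Eventually.of_forall fun x ↦ le_max_right _ _)
    _ = _ := by simp [ENNReal.ofReal_max]

/-- Gibbs' variational lower bound for a Lebesgue integral, tested against a Gaussian. -/
theorem ofReal_exp_le_lintegral_exp_neg {m : ℕ} {v : NNReal} (hv : (v : ℝ) = (2 * Real.pi)⁻¹)
    {G : (Fin m → ℝ) → ℝ}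
    (hG : Integrable G (Measure.pi fun _ : Fin m ↦ gaussianReal 0 v)) :
    ENNReal.ofReal (Real.exp (m / 2 - ∫ x, G x ∂(Measure.pi fun _ : Fin m ↦ gaussianReal 0 v)))
      ≤ ∫⁻ x : Fin m → ℝ, ENNReal.ofReal (Real.exp (-G x)) := by
  have hpi := Real.pi_pos
  have hv0 : v ≠ 0 := by
    have : (0 : ℝ) < v := by rw [hv]; positivity
    exact_mod_cast this.ne'
  set μ : Measure (Fin m → ℝ) := Measure.pi fun _ : Fin m ↦ gaussianReal 0 v with hμ
  set c := m / 2 - ∫ x, G x ∂μ with hc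
  -- `Z` is the logarithm of $e^{-G}$ over the Gaussian density, with mean `c`; the tangent line of
  -- `exp` at `c` gives the bound.
  set Z : (Fin m → ℝ) → ℝ := fun x ↦ Real.pi * ∑ j, x j ^ 2 - G x with hZ
  have hsqi : Integrable (fun x : Fin m → ℝ ↦ Real.pi * ∑ j, x j ^ 2) μ :=
    (integrable_finsetSum _ fun j _ ↦ (integral_pi_gaussianReal_sq v j).1).const_mul _
  have hZi : Integrable Z μ := hsqi.sub hG
  have hZint : ∫ x, Z x ∂μ = c := by
    rw [hZ, integral_sub hsqi hG, integral_const_mul,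
      integral_finsetSum _ fun j _ ↦ (integral_pi_gaussianReal_sq v j).1]
    simp_rw [hμ, (integral_pi_gaussianReal_sq v _).2]
    rw [hc, Finset.sum_const, Finset.card_univ, Fintype.card_fin, nsmul_eq_mul, hv]
    congr 1
    field_simp
  have hpdf : ∀ x : Fin m → ℝ,
      ∏ j, gaussianPDFReal 0 v (x j) = Real.exp (-(Real.pi * ∑ j, x j ^ 2)) := by
    intro x
    have : ∀ y, gaussianPDFReal 0 v y = Real.exp (-(Real.pi * y ^ 2)) := by
      intro y
      have e1 : 2 * Real.pi * (2 * Real.pi)⁻¹ = 1 := by field_simp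
      have e2 : -(y - 0) ^ 2 / (2 * (2 * Real.pi)⁻¹) = -(Real.pi * y ^ 2) := by field_simp; ring
      rw [gaussianPDFReal_def, hv]
      simp only [e1, e2]
      simp
    simp_rw [this]
    rw [← Real.exp_sum, Finset.sum_neg_distrib, Finset.mul_sum]
  calc ENNReal.ofReal (Real.exp c)
      = ENNReal.ofReal (∫ x, Real.exp c * (1 + (Z x - c)) ∂μ) := by
        have : ∫ x, (1 + (Z x - c)) ∂μ = 1 := by
          rw [integral_add (f := fun _ ↦ (1 : ℝ)) (g := fun x ↦ Z x - c) (integrable_const _)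
            (hZi.sub (integrable_const _)), integral_sub hZi (integrable_const _), hZint]
          simp
        rw [integral_const_mul, this, mul_one]
    _ ≤ ∫⁻ x, ENNReal.ofReal (Real.exp c * (1 + (Z x - c))) ∂μ :=
        ofReal_integral_le_lintegral_ofReal
          (((integrable_const _).add (hZi.sub (integrable_const _))).const_mul _)
    _ ≤ ∫⁻ x, ENNReal.ofReal (Real.exp (Z x)) ∂μ := by
        refine lintegral_mono fun x ↦ ENNReal.ofReal_le_ofReal ?_
        rw [show Z x = c + (Z x - c) by ring, Real.exp_add, show c + (Z x - c) - c = Z x - c by ring]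
        gcongr
        linarith [Real.add_one_le_exp (Z x - c)]
    _ ≤ ∫⁻ x : Fin m → ℝ, ENNReal.ofReal (∏ j, gaussianPDFReal 0 v (x j)) *
          ENNReal.ofReal (Real.exp (Z x)) := by
        rw [hμ, pi_gaussianReal_eq_withDensity hv0]
        refine lintegral_withDensity_le_lintegral_mul _ ?_ _
        have := measurable_gaussianPDFReal 0 v
        fun_prop
    _ = _ := by
        refine lintegral_congr fun x ↦ ?_
        rw [hpdf, ← ENNReal.ofReal_mul (Real.exp_pos _).le, ← Real.exp_add]
        congr 2
        simp only [hZ]; ring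

/-- A form of Minkowski's linear forms theorem for more forms than variables. -/
theorem exp_le_ncard_of_forms {m N : ℕ} (b : Module.Basis (Fin m) ℝ (Fin m → ℝ))
    (hb : |(Matrix.of b).det| = 1) (u : Fin N → Fin m → ℝ) (hpos : ∀ n, 0 < ∑ j, u n j ^ 2)
    (hle : ∀ n, ∑ j, u n j ^ 2 ≤ 1) (htr : ∑ n, ∑ j, u n j ^ 2 ≤ m) {S : Set (Fin m → ℤ)}
    (hfin : S.Finite)
    (hS : ∀ a : Fin m → ℤ, (∀ n, |∑ j, u n j * (∑ k, a k • b k) j| ≤ √2) → a ∈ S) :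
    Real.exp (0.06 * m) ≤ S.ncard := by
  have hpi := Real.pi_pos
  set Q : Fin N → ℝ := fun n ↦ ∑ j, u n j ^ 2 with hQ
  -- This ratio makes both costs linear in `Q n`: at most 0.11 for the normalization and 0.33 for
  -- the tails, together below 1/2.
  set r : Fin N → ℝ := fun n ↦ Q n / 20 with hr
  have hr0 : ∀ n, 0 < r n := fun n ↦ div_pos (hpos n) (by norm_num)
  have hr1 : ∀ n, r n < 1 := fun n ↦ by
    have := hle n
    simp only [hr, hQ]; linarith
  -- Dividing by `√2` turns unit rounding cells into the bound `√2` and gives `y n` the variance `Q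
  -- n / (4π)`.
  set y : Fin N → (Fin m → ℝ) →ₗ[ℝ] ℝ := fun n ↦ ∑ j, (u n j / √2) • LinearMap.proj j with hy
  have hy_apply : ∀ n x, y n x = ∑ j, u n j / √2 * x j := fun n x ↦ by simp [hy]
  have hy_meas : ∀ n, Measurable (y n) := fun n ↦ by
    rw [funext (hy_apply n)]; fun_prop
  set ℓ : (Fin m → ℤ) →+ (Fin m → ℝ) := AddMonoidHom.mk' (fun a ↦ ∑ k, a k • b k)
    (fun a a' ↦ by simp [add_smul, Finset.sum_add_distrib]) with hℓ
  set v : NNReal := ⟨(2 * Real.pi)⁻¹, by positivity⟩ with hv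
  set w : Fin N → NNReal := fun n ↦ ⟨Q n / (4 * Real.pi), div_nonneg (hpos n).le (by positivity)⟩
    with hw
  set μ : Measure (Fin m → ℝ) := Measure.pi fun _ : Fin m ↦ gaussianReal 0 v with hμ
  set A : Fin N → ℝ := fun n ↦ Real.log ((1 + r n) / (1 - r n)) with hA
  have hD : ∀ n, 0 ≤ -Real.log (r n) := fun n ↦
    neg_nonneg.2 (Real.log_nonpos (hr0 n).le (hr1 n).le)
  have hlaw : ∀ n, μ.map (y n) = gaussianReal 0 (w n) := by
    intro n
    rw [funext (hy_apply n)]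
    refine map_sum_mul_pi_gaussianReal v (w n) _ ?_
    have hv' : (v : ℝ) = (2 * Real.pi)⁻¹ := rfl
    have hw' : (w n : ℝ) = (∑ j, u n j ^ 2) / (4 * Real.pi) := rfl
    simp only [hw', hv', div_pow, Real.sq_sqrt (show (0 : ℝ) ≤ 2 by norm_num)]
    rw [← Finset.sum_div]
    field_simp
    norm_num
  set G : (Fin m → ℝ) → ℝ := fun x ↦ ∑ n, (A n + -Real.log (r n) * roundBound (y n x)) with hG
  have hRi : ∀ n, Integrable (fun x ↦ roundBound (y n x)) μ := fun n ↦ by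
    have := integrable_roundBound_gaussianReal (w n)
    rw [← hlaw n] at this
    exact this.comp_measurable (hy_meas n)
  have hRint : ∀ n, ∫ x, roundBound (y n x) ∂μ = ∫ t, roundBound t ∂(gaussianReal 0 (w n)) :=
    fun n ↦ by
      rw [← hlaw n, integral_map (hy_meas n).aemeasurable
        measurable_roundBound.aestronglyMeasurable]
  have hterm : ∀ n, Integrable (fun x ↦ A n + -Real.log (r n) * roundBound (y n x)) μ := fun n ↦
    (integrable_const _).add ((hRi n).const_mul _)
  have hGi : Integrable G μ := integrable_finsetSum _ fun n _ ↦ hterm n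
  have hGint : ∫ x, G x ∂μ ≤ 0.44 * m := by
    rw [hG, integral_finsetSum _ fun n _ ↦ hterm n]
    calc ∑ n, ∫ x, (A n + -Real.log (r n) * roundBound (y n x)) ∂μ
        ≤ ∑ n, 0.44 * Q n := by
          refine Finset.sum_le_sum fun n _ ↦ ?_
          rw [integral_add (integrable_const _) ((hRi n).const_mul _), integral_const_mul, hRint]
          have h1 := log_one_add_div_one_sub_le (hpos n) (hle n)
          have h2 := neg_log_mul_integral_roundBound_le (hpos n) (hle n) (w := w n) rfl
          simp only [integral_const, probReal_univ, one_smul]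
          simp only [hA, hr, hQ] at h1 h2 ⊢
          linarith
      _ = 0.44 * ∑ n, Q n := (Finset.mul_sum _ _ _).symm
      _ ≤ 0.44 * m := by gcongr
  have hlow := ofReal_exp_le_lintegral_exp_neg (v := v) rfl hGi
  set f : (Fin m → ℝ) → ENNReal :=
    fun x ↦ ∏ n, ENNReal.ofReal (geomWeight (r n) (round (y n x))) with hf
  have hfm : Measurable f := by
    refine Finset.measurable_prod _ fun n _ ↦ ?_
    have h1 : Measurable fun k : ℤ ↦ ENNReal.ofReal (geomWeight (r n) k) := measurable_from_top
    have h2 : Measurable fun t : ℝ ↦ round t := by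
      simp_rw [round_eq]
      exact Int.measurable_floor.comp (measurable_id.add_const _)
    exact h1.comp (h2.comp (hy_meas n))
  have hGf : ∀ x, ENNReal.ofReal (Real.exp (-G x)) ≤ f x := by
    intro x
    rw [hf, hG]
    simp only
    rw [← Finset.sum_neg_distrib, Real.exp_sum, ENNReal.ofReal_prod_of_nonneg
      fun _ _ ↦ (Real.exp_pos _).le]
    refine Finset.prod_le_prod' fun n _ ↦ ENNReal.ofReal_le_ofReal ?_
    rw [geomWeight, Real.exp_le_exp, neg_le_neg_iff]
    have := mul_le_mul_of_nonneg_left (abs_round_le_roundBound (y n x)) (hD n)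
    simp only [hA]
    linarith
  have hup : ∫⁻ x, f x ≤ (S.ncard : ENNReal) := by
    refine lintegral_le_of_tsum_le b hb hfm fun s ↦ ?_
    refine tsum_prod_round_le y ℓ (fun n k ↦ ENNReal.ofReal (geomWeight (r n) k))
      (fun n ↦ tsum_geomWeight_le (hr0 n) (hr1 n)) hfin (fun a ha ↦ hS a fun n ↦ ?_) s
    have h1 := ha n
    have h2 : y n (ℓ a) = (∑ j, u n j * (∑ k, a k • b k) j) / √2 := by
      rw [hy_apply, Finset.sum_div]
      exact Finset.sum_congr rfl fun j _ ↦ div_mul_eq_mul_div _ _ _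
    rwa [h2, abs_div, abs_of_pos (Real.sqrt_pos.2 (by norm_num : (0 : ℝ) < 2)),
      div_le_one (by positivity)] at h1
  have hall := (hlow.trans (lintegral_mono hGf)).trans hup
  rw [← ENNReal.ofReal_natCast, ENNReal.ofReal_le_ofReal_iff (Nat.cast_nonneg _)] at hall
  refine le_trans (Real.exp_le_exp.2 ?_) hall
  linarith

/-! ### Integer combinations of binomial polynomials -/

/-- The polynomial `∑ k, a k * (X choose k)`. -/
noncomputable def binomCombination {m : ℕ} (a : Fin m → ℤ) : Polynomial ℝ :=
  ∑ k : Fin m, Polynomial.C ((a k : ℝ) / (k : ℕ).factorial) * descPochhammer ℝ k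

theorem eval_binomCombination {m : ℕ} (a : Fin m → ℤ) (n : ℕ) :
    (binomCombination a).eval (n : ℝ) = ∑ k : Fin m, (a k : ℝ) * n.choose k := by
  rw [binomCombination, Polynomial.eval_finsetSum]
  refine Finset.sum_congr rfl fun k _ ↦ ?_
  rw [Polynomial.eval_mul, Polynomial.eval_C, descPochhammer_eval_eq_descFactorial,
    Nat.descFactorial_eq_factorial_mul_choose]
  have : ((k : ℕ).factorial : ℝ) ≠ 0 := by positivity
  push_cast
  field_simp

theorem det_eq_one_of_choose {R : Type*} [CommRing R] {m : ℕ} (f : ℕ → ℕ → R)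
    (hf : ∀ k, f k k = 1) :
    (Matrix.of fun n k : Fin m ↦ (((n : ℕ).choose k : ℕ) : R) * f n k).det = 1 := by
  rw [Matrix.det_of_isLowerTriangular]
  · simp [hf]
  · intro i j hij
    have : (i : ℕ) < j := hij
    simp [Nat.choose_eq_zero_of_lt this]

theorem binomCombination_values_injective (m : ℕ) :
    Function.Injective fun (a : Fin m → ℤ) (n : Fin m) ↦ ∑ k : Fin m, a k * ((n : ℕ).choose k : ℤ) := by
  intro a a' h
  have hdet := det_eq_one_of_choose (R := ℤ) (m := m) (fun _ _ ↦ 1) (fun _ ↦ rfl)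
  rw [← sub_eq_zero]
  refine Matrix.eq_zero_of_mulVec_eq_zero (by rw [hdet]; exact one_ne_zero) ?_
  ext n
  have := congrFun h n
  simp only at this
  simp only [Matrix.mulVec, dotProduct, Matrix.of_apply, mul_one, Pi.sub_apply, Pi.zero_apply,
    mul_sub, Finset.sum_sub_distrib]
  simp only [mul_comm _ (a _), mul_comm _ (a' _)]
  rw [this, sub_self]

theorem binomCombination_injective (m : ℕ) :
    Function.Injective (binomCombination : (Fin m → ℤ) → Polynomial ℝ) := by
  intro a a' h
  refine binomCombination_values_injective m (funext fun n ↦ ?_)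
  have := congrArg (Polynomial.eval ((n : ℕ) : ℝ)) h
  rw [eval_binomCombination, eval_binomCombination] at this
  exact_mod_cast this

/-- The values at `0, …, m - 1` are integers and determine `a`. -/
theorem finite_binomCombination_bounded (m : ℕ) (B : ℕ → ℝ) :
    {a : Fin m → ℤ | ∀ n < m, |(binomCombination a).eval (n : ℝ)| ≤ B n}.Finite := by
  refine ((Set.finite_Icc (fun n : Fin m ↦ -⌈B n⌉) (fun n : Fin m ↦ ⌈B n⌉)).preimage
    (binomCombination_values_injective m).injOn).subset fun a ha ↦ ?_
  have key : ∀ n : Fin m, |∑ k : Fin m, a k * ((n : ℕ).choose k : ℤ)| ≤ ⌈B n⌉ := by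
    intro n
    have := (ha n n.2).trans (Int.le_ceil _)
    rw [eval_binomCombination] at this
    exact_mod_cast this
  exact ⟨fun n ↦ (abs_le.1 (key n)).1, fun n ↦ (abs_le.1 (key n)).2⟩

theorem eventually_abs_eval_le_pow (P : Polynomial ℝ) {r : ℝ} (hr : 1 < r) :
    ∀ᶠ n : ℕ in Filter.atTop, |P.eval (n : ℝ)| ≤ r ^ n := by
  have h : (fun n : ℕ ↦ P.eval (n : ℝ)) =o[Filter.atTop] fun n : ℕ ↦ r ^ n := by
    simp_rw [Polynomial.eval_eq_sum_range]
    exact Asymptotics.IsLittleO.fun_sum (A := fun i (n : ℕ) ↦ P.coeff i * (n : ℝ) ^ i) fun i _ ↦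
      (isLittleO_pow_const_const_pow_of_one_lt (R := ℝ) i hr).const_mul_left _
  filter_upwards [h.bound one_pos] with n hn
  rwa [one_mul, Real.norm_eq_abs, Real.norm_of_nonneg (by positivity)] at hn

theorem exists_eventual_bound {m : ℕ} {S : Set (Fin m → ℤ)} (hS : S.Finite) {r : ℝ} (hr : 1 < r) :
    ∃ N : ℕ, ∀ a ∈ S, ∀ n ≥ N, |(binomCombination a).eval (n : ℝ)| ≤ r ^ n := by
  have h := (Filter.eventually_all_finite hS).2 fun a _ ↦
    eventually_abs_eval_le_pow (binomCombination a) hr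
  obtain ⟨N, hN⟩ := Filter.eventually_atTop.1 h
  exact ⟨N, fun a ha n hn ↦ hN n hn a ha⟩

/-! ### Counting and conclusion -/

open Real in
theorem exp_le_ncard_binomCombination {m N : ℕ} (hm : 0 < m) (hN : m ≤ N) :
    exp (0.06 * m) ≤ {a : Fin m → ℤ | ∀ n < N, |(binomCombination a).eval (n : ℝ)| ≤
      √(2 * goldenRatio) * goldenRatio ^ n}.ncard := by
  set φ := goldenRatio with hφ
  have hφ0 : 0 < φ := goldenRatio_pos
  have hφ1 : 1 < φ := one_lt_goldenRatio
  have hφ2 : φ ^ 2 = φ + 1 := goldenRatio_sq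
  set α := φ⁻¹ with hα
  have hα0 : 0 < α := inv_pos.2 hφ0
  have hα1 : α < 1 := inv_lt_one_of_one_lt₀ hφ1
  have hαφ : α * φ = 1 := inv_mul_cancel₀ hφ0.ne'
  have hαα : α * (1 + α) = 1 := by
    have : α = φ - 1 := by
      exact inv_eq_of_mul_eq_one_right (by nlinarith)
    rw [this]; nlinarith
  have hαinv : (1 - α ^ 2)⁻¹ = φ := by
    have : 1 - α ^ 2 = α := by linarith
    rw [this, hα, inv_inv]
  set bv : Fin m → Fin m → ℝ := fun k j ↦ ((k : ℕ).choose j : ℝ) * α ^ ((k : ℕ) - j) with hbv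
  have hdet : (Matrix.of bv).det = 1 :=
    det_eq_one_of_choose (fun k j ↦ α ^ (k - j)) (fun k ↦ by simp)
  have hli : LinearIndependent ℝ bv :=
    Matrix.linearIndependent_rows_of_det_ne_zero (A := Matrix.of bv) (by rw [hdet]; exact one_ne_zero)
  have : Nonempty (Fin m) := ⟨⟨0, hm⟩⟩
  set b := basisOfLinearIndependentOfCardEqFinrank hli (by simp) with hb
  have hbcoe : ⇑b = bv := coe_basisOfLinearIndependentOfCardEqFinrank _ _
  set u : Fin N → Fin m → ℝ := fun n j ↦ shiftedEval α n j / √φ with hu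
  have hsq : ∀ n j, u n j ^ 2 = shiftedEval α n j ^ 2 / φ := fun n j ↦ by
    simp only [hu, div_pow, sq_sqrt hφ0.le]
  refine exp_le_ncard_of_forms b (by rw [hbcoe, hdet, abs_one]) u (fun n ↦ ?_) (fun n ↦ ?_) ?_ ?_ ?_
  · refine Finset.sum_pos' (fun j _ ↦ sq_nonneg _) ⟨⟨0, hm⟩, Finset.mem_univ _, ?_⟩
    rw [hsq, shiftedEval_zero_right]
    positivity
  · simp_rw [hsq]
    rw [← Finset.sum_div, div_le_one hφ0, Fin.sum_univ_eq_sum_range (fun j ↦ shiftedEval α n j ^ 2),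
      ← hαinv]
    exact sum_shiftedEval_sq_row hα0.le hα1 hαα m n
  · rw [Finset.sum_comm]
    have : ∀ j : Fin m, ∑ n : Fin N, u n j ^ 2 ≤ 1 := by
      intro j
      simp_rw [hsq]
      rw [← Finset.sum_div, div_le_one hφ0,
        Fin.sum_univ_eq_sum_range (fun n ↦ shiftedEval α n j ^ 2), ← hαinv]
      exact sum_shiftedEval_sq_col hα0.le hα1 hαα N j
    simpa using Finset.sum_le_sum fun j (_ : j ∈ Finset.univ) ↦ this j
  · exact (finite_binomCombination_bounded m fun n ↦ √(2 * φ) * φ ^ n).subset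
      fun a ha n hn ↦ ha n (hn.trans_le hN)
  · intro a ha n hn
    have h := ha ⟨n, hn⟩
    have e : ∑ j, u ⟨n, hn⟩ j * (∑ k, a k • b k) j
        = (binomCombination a).eval (n : ℝ) / (√φ * φ ^ n) := by
      rw [eval_binomCombination, hbcoe]
      simp only [Finset.sum_apply, zsmul_eq_mul, Finset.mul_sum]
      rw [Finset.sum_comm, Finset.sum_div]
      refine Finset.sum_congr rfl fun k _ ↦ ?_
      have h1 := sum_choose_mul_shiftedEval α k.2 n
      rw [← Fin.sum_univ_eq_sum_range
        (fun j ↦ ((k : ℕ).choose j : ℝ) * α ^ ((k : ℕ) - j) * shiftedEval α n j)] at h1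
      calc ∑ j, u ⟨n, hn⟩ j * ((a k : ℝ) * bv k j)
          = (a k : ℝ) / √φ * ∑ j : Fin m,
              ((k : ℕ).choose j : ℝ) * α ^ ((k : ℕ) - j) * shiftedEval α n j := by
            rw [Finset.mul_sum]
            refine Finset.sum_congr rfl fun j _ ↦ ?_
            simp only [hu, hbv]; ring
        _ = _ := by
            rw [h1, hα, inv_pow]
            have := sqrt_pos.2 hφ0
            field_simp
    have hs : 0 < √φ := sqrt_pos.2 hφ0
    rw [e, abs_div, abs_of_pos (by positivity : 0 < √φ * φ ^ n), div_le_iff₀ (by positivity)] at h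
    rw [sqrt_mul (by norm_num), mul_assoc]
    exact h

theorem theorem1 (ε : ℝ) (hε : 0 < ε) :
    {P : Polynomial ℝ | IsIntegerValued P ∧
      ∀ n : ℕ, |P.eval (n : ℝ)| ≤
        (Real.sqrt (2 * Real.goldenRatio) + ε) * Real.goldenRatio ^ n}.Infinite := by
  intro hT
  set T := {P : Polynomial ℝ | IsIntegerValued P ∧ ∀ n : ℕ, |P.eval (n : ℝ)| ≤
        (Real.sqrt (2 * Real.goldenRatio) + ε) * Real.goldenRatio ^ n} with hTdef
  have hφ := Real.one_lt_goldenRatio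
  obtain ⟨m, hm⟩ := exists_nat_gt ((T.ncard : ℝ) / 0.06)
  have hm0 : 0 < m := by
    have : (0 : ℝ) < m := lt_of_le_of_lt (by positivity) hm
    exact_mod_cast this
  -- The finite set is cut out by `n < m` alone, so it is fixed before `N` is chosen.
  obtain ⟨N₀, hN₀⟩ := exists_eventual_bound (finite_binomCombination_bounded m
    fun n ↦ √(2 * Real.goldenRatio) * Real.goldenRatio ^ n) hφ
  set N := max m N₀ with hN
  have hcard := exp_le_ncard_binomCombination hm0 (le_max_left m N₀)
  rw [← hN] at hcard
  have hle : {a : Fin m → ℤ | ∀ n < N, |(binomCombination a).eval (n : ℝ)| ≤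
      √(2 * Real.goldenRatio) * Real.goldenRatio ^ n}.ncard ≤ T.ncard := by
    refine Set.ncard_le_ncard_of_injOn binomCombination (fun a ha ↦ ⟨fun n ↦ ?_, fun n ↦ ?_⟩)
      (binomCombination_injective m).injOn hT
    · exact ⟨∑ k : Fin m, a k * (n.choose k : ℤ), by rw [eval_binomCombination]; push_cast; rfl⟩
    · have hp : 0 < Real.goldenRatio ^ n := pow_pos Real.goldenRatio_pos n
      have hs : 1 ≤ √(2 * Real.goldenRatio) := Real.one_le_sqrt.2 (by linarith)
      rcases lt_or_ge n N with h | h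
      · refine (ha n h).trans ?_
        gcongr
        linarith
      · refine (hN₀ a (fun i hi ↦ ha i (lt_max_of_lt_left hi)) n
          ((le_max_right _ _).trans h)).trans ?_
        exact le_mul_of_one_le_left hp.le (by linarith)
  have h1 : Real.exp (0.06 * m) ≤ T.ncard := hcard.trans (by exact_mod_cast hle)
  have h2 := Real.add_one_le_exp (0.06 * (m : ℝ))
  rw [div_lt_iff₀ (by norm_num)] at hm
  linarith
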